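/- All graphs are finite and simple. For a real number $\lambda>0$ let $k(\lambda)\in\mathbb N\cup\{\infty\}$ be the smallest integer $k$ such that some graph on $k$ vertices has spectral radius (largest eigenvalue of its adjacency matrix) exactly $\lambda$, with $k(\lambda)=\infty$ if there is no such graph. A signed graph $G^\pm$ is a graph each of whose edges is labeled $+$ or $-$; its signed adjacency matrix has entry $1$ at positive edges, $-1$ at negative edges and $0$ elsewhere. Let $|G^\pm|$ be its number of vertices, $\lambda_1(G^\pm)$ the largest eigenvalue of the signed adjacency matrix, and $\mathrm{mult}(\lambda,G^\pm)$ the multiplicity of $\lambda$ as an eigenvalue of it. A valid $t$-coloring of $G^\pm$ is a coloring of the vertices with $t$ colors in which the endpoints of every negative edge have distinct colors and the endpoints of every positive edge have identical colors; the chromatic number $\chi(G^\pm)$ is the smallest $t$ for which a valid $t$-coloring exists ($\infty$ if there is none). For $p\in\mathbb N$ put $$k_p(\lambda)=\inf\left\{\frac{|G^\pm|}{\mathrm{mult}(\lambda,G^\pm)} : \chi(G^\pm)\le p \text{ and } \lambda_1(G^\pm)=\lambda\right\}\in[0,\infty],\qquad \inf\emptyset=\infty .$$ Then for all real $\lambda>0$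 and all integers $p\ge 2$, $$k_p(\lambda)\ \ge\ \frac{p\,k(\lambda)}{p\,k(\lambda)-2\lambda}.$$ Here, if $k(\lambda)<\infty$, the denominator $p\,k(\lambda)-2\lambda$ is positive; if $k(\lambda)=\infty$, the right-hand side is read as its limit $1$ as $k(\lambda)\to\infty$. -/

import Mathlib

namespace TwoDistance

/-- A signed graph on the vertex set `V`: a (simple) graph each of whose edges is labelled by
`+` or `-`. It is given by the graph of its positive edges and the graph of its negative edges,
which have no edge in common. -/
@[ext]
structure SignedGraph (V : Type*) where
  pos : SimpleGraph V
  neg : SimpleGraph V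
  disj : ∀ u v, pos.Adj u v → ¬ neg.Adj u v

section Spectra

variable {V : Type*} [Fintype V] [DecidableEq V]

/-- The multiplicity of `x` as an eigenvalue of a symmetric real matrix `A`: the number of
indices `i` such that the `i`-th eigenvalue (listed with multiplicity) equals `x`. -/
noncomputable def eigMult {A : Matrix V V ℝ} (hA : A.IsHermitian) (x : ℝ) : ℕ :=
  {i | hA.eigenvalues i = x}.ncard

/-- `x` is the largest eigenvalue of the symmetric real matrix `A`. (A matrix of size zero has
no largest eigenvalue.) -/
def IsTopEigenvalue {A : Matrix V V ℝ} (hA : A.IsHermitian) (x : ℝ) : Prop :=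
  IsGreatest (Set.range hA.eigenvalues) x

end Spectra

section Graphs

variable {V : Type*}

open Classical in
/-- The adjacency matrix of a graph, over the reals. -/
noncomputable def adjMat (G : SimpleGraph V) : Matrix V V ℝ :=
  G.adjMatrix ℝ

theorem adjMat_isHermitian (G : SimpleGraph V) : (adjMat G).IsHermitian := by
  classical
  ext i j
  simp [adjMat, G.adj_comm]

open Classical in
/-- The signed adjacency matrix: entry `1` at positive edges, `-1` at negative edges and `0`
elsewhere. -/
noncomputable def SignedGraph.adjMat (G : SignedGraph V) : Matrix V V ℝ :=
  Matrix.of fun i j => if G.pos.Adj i j then 1 else if G.neg.Adj i j then -1 else 0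

theorem SignedGraph.adjMat_isHermitian (G : SignedGraph V) : G.adjMat.IsHermitian := by
  classical
  ext i j
  simp [SignedGraph.adjMat, G.pos.adj_comm, G.neg.adj_comm]

/-- A valid `t`-coloring of a signed graph: endpoints of negative edges have distinct colors,
endpoints of positive edges have identical colors. -/
def SignedGraph.IsValidColoring (G : SignedGraph V) {t : ℕ} (c : V → Fin t) : Prop :=
  (∀ u v, G.neg.Adj u v → c u ≠ c v) ∧ (∀ u v, G.pos.Adj u v → c u = c v)

/-- The chromatic number of a signed graph: the smallest `t` for which there is a valid
`t`-coloring, and `∞` if there is no such `t`. -/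
noncomputable def SignedGraph.chromaticNumber (G : SignedGraph V) : ℕ∞ :=
  sInf {s : ℕ∞ | ∃ t : ℕ, s = t ∧ ∃ c : V → Fin t, G.IsValidColoring c}

end Graphs

/-- The spectral radius order `k(x)`: the smallest `k` for which some graph on `k` vertices has
spectral radius (largest adjacency eigenvalue) exactly `x`, and `∞` if there is none. -/
noncomputable def spectralRadiusOrder (x : ℝ) : ℕ∞ :=
  sInf {s : ℕ∞ | ∃ k : ℕ, s = k ∧
    ∃ G : SimpleGraph (Fin k), IsTopEigenvalue (adjMat_isHermitian G) x}

/-- The parameter `k_p(x)`: the infimum of (number of vertices) / (multiplicity of `x`) over all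
finite signed graphs with chromatic number at most `p` and largest eigenvalue `x`. The
infimum of the empty set is `∞`. -/
noncomputable def kp (p : ℕ) (x : ℝ) : ENNReal :=
  sInf {r : ENNReal | ∃ (n : ℕ) (G : SignedGraph (Fin n)),
    G.chromaticNumber ≤ p ∧ IsTopEigenvalue G.adjMat_isHermitian x ∧
    r = (n : ENNReal) / (eigMult G.adjMat_isHermitian x : ENNReal)}

end TwoDistance

namespace TwoDistance

open Matrix

/-! Put `M = λ - A`, where `A` is the signed adjacency matrix on `n` vertices; `M` is positive
semidefinite and the multiplicity of `λ` is its corank. Between two color classes every edge is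
negative, and inside each every edge is positive, so switching one class turns that part of `A` into
an ordinary adjacency matrix. For an ordinary graph with spectrum at most `λ`, Perron–Frobenius
gives at most one dimension of `λ`-eigenvectors per component, and only on components with at least
`k = k(λ)` vertices. Hence two classes with `w` vertices force `rank M ≥ (1 - 1/k) w`. Averaging
over cyclically consecutive pairs of the `p` classes gives `p k · rank M ≥ 2 (k - 1) n ≥ 2 λ n`,
using `λ ≤ k - 1`; substituting `rank M = n - mult` gives the bound. -/

/-- An isotropic vector of a positive semidefinite matrix is in its kernel. -/
theorem mulVec_eq_zero_of_quadForm_nonpos {V : Type*} [Fintype V] {M : Matrix V V ℝ}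
    (hM : M.PosSemidef) {y : V → ℝ}
    (hy : y ⬝ᵥ (M *ᵥ y) ≤ 0) : M *ᵥ y = 0 := by
  have h0 : star y ⬝ᵥ (M *ᵥ y) = 0 := le_antisymm (by simpa using hy)
    (hM.dotProduct_mulVec_nonneg y)
  exact (hM.dotProduct_mulVec_zero_iff y).1 h0

/-! ### Eigenvalues in terms of `x - A` -/

section Spectra

variable {V : Type*} [Fintype V] [DecidableEq V]

theorem smul_one_sub_eq_conj {A : Matrix V V ℝ} (hA : A.IsHermitian) (x : ℝ) :
    x • (1 : Matrix V V ℝ) - A = (hA.eigenvectorUnitary : Matrix V V ℝ) *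
      diagonal (fun i => x - hA.eigenvalues i) *
        star (hA.eigenvectorUnitary : Matrix V V ℝ) := by
  have h1 : diagonal (fun i => x - hA.eigenvalues i) =
      x • (1 : Matrix V V ℝ) - diagonal hA.eigenvalues := by
    ext i j
    by_cases h : i = j <;> simp [h, diagonal, one_apply]
  have h2 := hA.spectral_theorem
  rw [Unitary.conjStarAlgAut_apply] at h2
  have h3 : (RCLike.ofReal ∘ hA.eigenvalues : V → ℝ) = hA.eigenvalues := by
    ext i; simp
  rw [h3] at h2
  rw [h1, Matrix.mul_sub, Matrix.sub_mul, ← h2]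
  simp

theorem isUnit_eigenvectorUnitary {A : Matrix V V ℝ} (hA : A.IsHermitian) :
    IsUnit (hA.eigenvectorUnitary : Matrix V V ℝ) :=
  ⟨Unitary.toUnits hA.eigenvectorUnitary, rfl⟩

/-- The multiplicity of an eigenvalue is the corank of `x - A`. -/
theorem rank_smul_one_sub_add_eigMult {A : Matrix V V ℝ} (hA : A.IsHermitian) (x : ℝ) :
    (x • (1 : Matrix V V ℝ) - A).rank + eigMult hA x = Fintype.card V := by
  have hU := isUnit_eigenvectorUnitary hA
  rw [smul_one_sub_eq_conj hA, rank_mul_eq_left_of_isUnit_det _ _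
      ((isUnit_iff_isUnit_det _).1 hU.star),
    rank_mul_eq_right_of_isUnit_det _ _ ((isUnit_iff_isUnit_det _).1 hU), rank_diagonal, eigMult,
    ← Nat.card_coe_set_eq, Nat.card_eq_fintype_card]
  have h := Fintype.card_subtype_compl (fun i => hA.eigenvalues i = x)
  have h' := Fintype.card_subtype_le (fun i => hA.eigenvalues i = x)
  have e : Fintype.card {i // x - hA.eigenvalues i ≠ 0} =
      Fintype.card {i // ¬ hA.eigenvalues i = x} :=
    Fintype.card_congr (Equiv.subtypeEquivRight fun i => by rw [ne_eq, sub_eq_zero, eq_comm])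
  rw [e, h]
  have e2 : Fintype.card ↥{i | hA.eigenvalues i = x} =
      Fintype.card {i // hA.eigenvalues i = x} := Fintype.card_congr (Equiv.refl _)
  omega

theorem posSemidef_smul_one_sub_iff {A : Matrix V V ℝ} (hA : A.IsHermitian) (x : ℝ) :
    (x • (1 : Matrix V V ℝ) - A).PosSemidef ↔ ∀ i, hA.eigenvalues i ≤ x := by
  rw [smul_one_sub_eq_conj hA,
    (isUnit_eigenvectorUnitary hA).posSemidef_star_right_conjugate_iff, posSemidef_diagonal_iff]
  simp

theorem det_smul_one_sub {A : Matrix V V ℝ} (hA : A.IsHermitian) (x : ℝ) :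
    (x • (1 : Matrix V V ℝ) - A).det = ∏ i, (x - hA.eigenvalues i) := by
  rw [smul_one_sub_eq_conj hA, det_mul_right_comm]
  simp

/-- Semidefiniteness and a kernel vector transfer to principal submatrices and relabelings more
easily than the eigenvalue list. -/
theorem isTopEigenvalue_iff {A : Matrix V V ℝ} (hA : A.IsHermitian) (x : ℝ) :
    IsTopEigenvalue hA x ↔ (x • (1 : Matrix V V ℝ) - A).PosSemidef ∧
      ∃ v ≠ 0, (x • (1 : Matrix V V ℝ) - A) *ᵥ v = 0 := by
  rw [posSemidef_smul_one_sub_iff hA, exists_mulVec_eq_zero_iff, det_smul_one_sub hA,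
    Finset.prod_eq_zero_iff, IsTopEigenvalue, IsGreatest, and_comm]
  simp only [mem_upperBounds, Set.mem_range, forall_exists_index,
    forall_apply_eq_imp_iff, Finset.mem_univ, true_and,
    sub_eq_zero, eq_comm (a := x)]

theorem IsTopEigenvalue.eigMult_pos {A : Matrix V V ℝ} {hA : A.IsHermitian} {x : ℝ}
    (h : IsTopEigenvalue hA x) : 0 < eigMult hA x :=
  (Set.ncard_pos (Set.toFinite _)).2 h.1

end Spectra


theorem adjMat_apply_of_adj {V : Type*} {G : SimpleGraph V} {u v : V} (h : G.Adj u v) :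
    adjMat G u v = 1 := by
  simp [adjMat, h]

theorem adjMat_apply_of_not_adj {V : Type*} {G : SimpleGraph V} {u v : V} (h : ¬ G.Adj u v) :
    adjMat G u v = 0 := by
  simp [adjMat, h]

theorem adjMat_nonneg {V : Type*} (G : SimpleGraph V) (u v : V) : 0 ≤ adjMat G u v := by
  by_cases h : G.Adj u v
  · simp [adjMat_apply_of_adj h]
  · simp [adjMat_apply_of_not_adj h]

theorem adjMat_comap {V W : Type*} (G : SimpleGraph V) (e : W → V) :
    adjMat (G.comap e) = (adjMat G).submatrix e e := by
  ext i j
  by_cases h : G.Adj (e i) (e j)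
  · rw [submatrix_apply, adjMat_apply_of_adj h, adjMat_apply_of_adj (by exact h)]
  · rw [submatrix_apply, adjMat_apply_of_not_adj h, adjMat_apply_of_not_adj (by exact h)]

theorem submatrix_smul_one_sub {V W : Type*} [DecidableEq V] [DecidableEq W]
    (A : Matrix V V ℝ) (x : ℝ) {e : W → V} (he : Function.Injective e) :
    (x • (1 : Matrix V V ℝ) - A).submatrix e e = x • (1 : Matrix W W ℝ) - A.submatrix e e := by
  ext i j
  simp [one_apply, he.eq_iff]

/-! ### Perron–Frobenius for unsigned graphs -/

section Graphs

variable {V : Type*} [Fintype V] [DecidableEq V]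

theorem smul_one_sub_mulVec_apply (A : Matrix V V ℝ) (x : ℝ) (y : V → ℝ) (v : V) :
    ((x • (1 : Matrix V V ℝ) - A) *ᵥ y) v = x * y v - ∑ u, A v u * y u := by
  simp only [sub_mulVec, smul_mulVec, one_mulVec, Pi.sub_apply, Pi.smul_apply, smul_eq_mul]
  rfl

theorem spectralRadiusOrder_le_card (G : SimpleGraph V) {x : ℝ}
    (h : IsTopEigenvalue (adjMat_isHermitian G) x) :
    spectralRadiusOrder x ≤ (Fintype.card V : ℕ∞) := by
  refine sInf_le ⟨Fintype.card V, rfl, G.comap (Fintype.equivFin V).symm, ?_⟩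
  set e := (Fintype.equivFin V).symm
  rw [isTopEigenvalue_iff] at h ⊢
  obtain ⟨hM, v, hv, hMv⟩ := h
  rw [adjMat_comap, ← submatrix_smul_one_sub _ _ e.injective]
  refine ⟨hM.submatrix e, v ∘ e, fun h0 => hv ?_, ?_⟩
  · ext i
    simpa using congrFun h0 (e.symm i)
  · rw [submatrix_mulVec_equiv]
    ext i
    simp [Function.comp_assoc, hMv]

/-- The largest eigenvalue of a graph is at most the number of other vertices. -/
theorem IsTopEigenvalue.le_card_sub_one {G : SimpleGraph V} {x : ℝ}
    (h : IsTopEigenvalue (adjMat_isHermitian G) x) : x ≤ Fintype.card V - 1 := by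
  obtain ⟨-, y, hy, hMy⟩ := (isTopEigenvalue_iff _ x).1 h
  obtain ⟨v0, hv0⟩ := Function.ne_iff.1 hy
  obtain ⟨v, -, hv⟩ := Finset.exists_max_image Finset.univ (fun v => |y v|) ⟨v0, Finset.mem_univ _⟩
  have hpos : 0 < |y v| := (abs_pos.2 hv0).trans_le (hv v0 (Finset.mem_univ _))
  have h1 : x * y v = ∑ u, adjMat G v u * y u := by
    have := congrFun hMy v
    rw [smul_one_sub_mulVec_apply] at this
    simpa [sub_eq_zero] using this
  have h2 : x * |y v| ≤ (Fintype.card V - 1) * |y v| :=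
    calc x * |y v| ≤ |x| * |y v| := by gcongr; exact le_abs_self x
      _ = |∑ u ∈ Finset.univ.erase v, adjMat G v u * y u| := by
        rw [← abs_mul, h1, Finset.sum_erase]
        rw [adjMat_apply_of_not_adj (G.irrefl), zero_mul]
      _ ≤ ∑ u ∈ Finset.univ.erase v, |adjMat G v u * y u| := Finset.abs_sum_le_sum_abs _ _
      _ ≤ ∑ u ∈ Finset.univ.erase v, |y v| := by
        refine Finset.sum_le_sum fun u _ => ?_
        by_cases hu : G.Adj v u
        · simpa [adjMat_apply_of_adj hu] using hv u (Finset.mem_univ _)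
        · simp [adjMat_apply_of_not_adj hu]
      _ = (Fintype.card V - 1) * |y v| := by
        have : 1 ≤ Fintype.card V := Fintype.card_pos_iff.2 ⟨v⟩
        simp [Finset.card_erase_of_mem, Nat.cast_sub this]
  exact le_of_mul_le_mul_right h2 hpos

/-- If `x` bounds the spectrum of a graph, the absolute value of an `x`-eigenvector is an
`x`-eigenvector. -/
theorem abs_mem_ker {G : SimpleGraph V} {x : ℝ}
    (hM : (x • (1 : Matrix V V ℝ) - adjMat G).PosSemidef) {y : V → ℝ}
    (hy : (x • (1 : Matrix V V ℝ) - adjMat G) *ᵥ y = 0) :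
    (x • (1 : Matrix V V ℝ) - adjMat G) *ᵥ |y| = 0 := by
  -- Passing to `|y|` keeps the diagonal term and can only increase the adjacency term, so the form
  -- stays at most `0`.
  refine mulVec_eq_zero_of_quadForm_nonpos hM ?_
  have h0 : y ⬝ᵥ ((x • (1 : Matrix V V ℝ) - adjMat G) *ᵥ y) = 0 := by simp [hy]
  rw [← h0]
  simp only [dotProduct, smul_one_sub_mulVec_apply]
  refine Finset.sum_le_sum fun v _ => ?_
  have h1 : |y| v * (x * |y| v) = y v * (x * y v) := by
    have := abs_mul_abs_self (y v)
    simp only [Pi.abs_apply]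
    linear_combination x * this
  have h2 : y v * ∑ u, adjMat G v u * y u ≤ |y| v * ∑ u, adjMat G v u * |y| u := by
    rw [Finset.mul_sum, Finset.mul_sum]
    refine Finset.sum_le_sum fun u _ => ?_
    calc y v * (adjMat G v u * y u) ≤ |y v * (adjMat G v u * y u)| := le_abs_self _
      _ = |y| v * (adjMat G v u * |y| u) := by
        rw [abs_mul, abs_mul, abs_of_nonneg (adjMat_nonneg G v u)]; rfl
  rw [mul_sub, mul_sub, h1]
  linarith

/-- An eigenvector for the spectral radius vanishes on whole connected components. -/
theorem eq_zero_of_reachable {G : SimpleGraph V} {x : ℝ}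
    (hM : (x • (1 : Matrix V V ℝ) - adjMat G).PosSemidef) {y : V → ℝ}
    (hy : (x • (1 : Matrix V V ℝ) - adjMat G) *ᵥ y = 0) {u v : V} (huv : G.Reachable u v)
    (hu : y u = 0) : y v = 0 := by
  have step : ∀ a b, G.Adj a b → y a = 0 → y b = 0 := by
    intro a b hab ha
    -- At a zero of `|y|`, the eigenvalue equation makes a sum of nonnegative terms over the
    -- neighbors vanish.
    have h := congrFun (abs_mem_ker hM hy) a
    rw [smul_one_sub_mulVec_apply] at h
    simp only [Pi.abs_apply, ha, abs_zero, mul_zero, zero_sub, Pi.zero_apply, neg_eq_zero] at h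
    have h' := (Finset.sum_eq_zero_iff_of_nonneg fun w _ =>
      mul_nonneg (adjMat_nonneg G a w) (abs_nonneg (y w))).1 h b (Finset.mem_univ _)
    simpa [adjMat_apply_of_adj hab] using h'
  obtain ⟨p⟩ := huv
  induction p with
  | nil => exact hu
  | cons h _ ih => exact ih (step _ _ h hu)

/-- A connected component supporting an eigenvector for the spectral radius `x` has at least
`k(x)` vertices. -/
theorem spectralRadiusOrder_le_ncard_supp {G : SimpleGraph V} {x : ℝ}
    (hM : (x • (1 : Matrix V V ℝ) - adjMat G).PosSemidef) {y : V → ℝ}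
    (hy : (x • (1 : Matrix V V ℝ) - adjMat G) *ᵥ y = 0) (c : G.ConnectedComponent)
    {v : V} (hv : v ∈ c.supp) (hyv : y v ≠ 0) :
    spectralRadiusOrder x ≤ (c.supp.ncard : ℕ∞) := by
  classical
  rw [← Nat.card_coe_set_eq, Nat.card_eq_fintype_card]
  refine spectralRadiusOrder_le_card (G.induce c.supp) ((isTopEigenvalue_iff _ x).2 ?_)
  have hA : adjMat (G.induce c.supp) = (adjMat G).submatrix (↑) (↑) :=
    adjMat_comap G Subtype.val
  rw [hA, ← submatrix_smul_one_sub _ _ Subtype.val_injective]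
  refine ⟨hM.submatrix _, fun w => y w, fun h => hyv (congrFun h ⟨v, hv⟩), ?_⟩
  rw [submatrix_smul_one_sub _ _ Subtype.val_injective]
  ext w
  rw [← hA, smul_one_sub_mulVec_apply, hA]
  simp only [submatrix_apply, Pi.zero_apply]
  have hw := congrFun hy w
  rw [smul_one_sub_mulVec_apply,
    ← Fintype.sum_subtype_add_sum_subtype (· ∈ c.supp) fun u => adjMat G w u * y u] at hw
  -- No edge leaves a component, so the kernel equation restricts to it.
  have h0 : ∑ u : {u // u ∉ c.supp}, adjMat G w u * y u = 0 :=
    Finset.sum_eq_zero fun u _ => by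
      rw [adjMat_apply_of_not_adj fun h => u.2 (c.mem_supp_of_adj_mem_supp w.2 h), zero_mul]
  rw [h0, add_zero] at hw
  exact hw

/-- The multiplicity of the spectral radius `x` is at most the number of vertices over
`k(x)`. -/
theorem mul_finrank_ker_le {G : SimpleGraph V} {x : ℝ} {k : ℕ} (hk : spectralRadiusOrder x = k)
    (hM : (x • (1 : Matrix V V ℝ) - adjMat G).PosSemidef) :
    k * Module.finrank ℝ (x • (1 : Matrix V V ℝ) - adjMat G).mulVecLin.ker ≤ Fintype.card V := by
  classical
  set M := x • (1 : Matrix V V ℝ) - adjMat G with hMdef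
  let C : Finset G.ConnectedComponent :=
    Finset.univ.filter fun c => ∃ y, M *ᵥ y = 0 ∧ ∃ v ∈ c.supp, y v ≠ 0
  -- Evaluation at one vertex of each component that supports some kernel vector.
  let f : M.mulVecLin.ker →ₗ[ℝ] (C → ℝ) :=
    LinearMap.pi fun c => LinearMap.proj (c : G.ConnectedComponent).out ∘ₗ Submodule.subtype _
  have hf : Function.Injective f := by
    rw [← LinearMap.ker_eq_bot, LinearMap.ker_eq_bot']
    rintro ⟨y, hy⟩ h
    have hy' : M *ᵥ y = 0 := hy
    ext v
    by_contra hv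
    have hv' : y v ≠ 0 := hv
    have hc : G.connectedComponentMk v ∈ C := by
      simp only [C, Finset.mem_filter, Finset.mem_univ, true_and]
      exact ⟨y, hy', v, rfl, hv'⟩
    have h1 : y (G.connectedComponentMk v).out = 0 := congrFun h ⟨_, hc⟩
    exact hv' (eq_zero_of_reachable hM hy' (SimpleGraph.ConnectedComponent.exact
      (Quot.out_eq (G.connectedComponentMk v))) h1)
  have h1 : Module.finrank ℝ M.mulVecLin.ker ≤ C.card := by
    simpa using LinearMap.finrank_le_finrank_of_injective hf
  calc k * Module.finrank ℝ M.mulVecLin.ker ≤ C.card * k := by rw [mul_comm]; gcongr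
    _ ≤ ∑ c ∈ C, (Finset.univ.filter fun v => G.connectedComponentMk v = c).card := by
      rw [← smul_eq_mul]
      refine Finset.card_nsmul_le_sum _ _ _ fun c hc => ?_
      obtain ⟨y, hy, v, hv, hyv⟩ := (Finset.mem_filter.1 hc).2
      have := spectralRadiusOrder_le_ncard_supp hM hy c hv hyv
      rw [hk, Nat.cast_le] at this
      refine this.trans_eq ?_
      rw [← Set.ncard_coe_finset]
      congr 1
      ext u
      simp [SimpleGraph.ConnectedComponent.mem_supp_iff]
    _ ≤ ∑ c, (Finset.univ.filter fun v => G.connectedComponentMk v = c).card :=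
      Finset.sum_le_sum_of_subset (Finset.subset_univ _)
    _ = Fintype.card V := by
      exact (Finset.card_eq_sum_card_fiberwise (s := Finset.univ) (t := Finset.univ)
        (f := G.connectedComponentMk) fun _ _ => by simp).symm

/-- The corank of `x - A` for a graph whose spectrum is bounded by `x`. -/
theorem mul_card_le_mul_rank {G : SimpleGraph V} {x : ℝ} {k : ℕ}
    (hk : spectralRadiusOrder x = k)
    (hM : (x • (1 : Matrix V V ℝ) - adjMat G).PosSemidef) :
    k * Fintype.card V ≤ k * (x • (1 : Matrix V V ℝ) - adjMat G).rank + Fintype.card V := by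
  have h := mul_finrank_ker_le hk hM
  have h2 := LinearMap.finrank_range_add_finrank_ker
    (x • (1 : Matrix V V ℝ) - adjMat G).mulVecLin
  rw [Module.finrank_fintype_fun_eq_card] at h2
  rw [← h2, Matrix.rank, mul_add, h2]
  omega

end Graphs


/-! ### Switching on two color classes and averaging -/

section SignedGraphs

variable {V : Type*}

theorem SignedGraph.exists_validColoring {G : SignedGraph V} {p : ℕ}
    (h : G.chromaticNumber ≤ p) : ∃ c : V → Fin p, G.IsValidColoring c := by
  have hne : {s : ℕ∞ | ∃ t : ℕ, s = t ∧ ∃ c : V → Fin t, G.IsValidColoring c}.Nonempty := by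
    by_contra h0
    rw [SignedGraph.chromaticNumber, Set.not_nonempty_iff_eq_empty.1 h0, sInf_empty] at h
    exact ENat.natCast_ne_top p (top_le_iff.1 h)
  obtain ⟨t, ht, c, hc⟩ := csInf_mem hne
  have htp : t ≤ p := by
    rw [SignedGraph.chromaticNumber, ht] at h
    exact_mod_cast h
  exact ⟨fun v => Fin.castLE htp (c v),
    fun u v huv he => hc.1 u v huv (Fin.castLE_injective htp he),
    fun u v huv => congrArg (Fin.castLE htp) (hc.2 u v huv)⟩

/-- The unsigned graph underlying a signed graph. -/
def SignedGraph.underlying (G : SignedGraph V) : SimpleGraph V := G.pos ⊔ G.neg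

/-- On two color classes of a valid coloring, a signed graph is switching equivalent to its
underlying graph. -/
theorem SignedGraph.exists_switching (G : SignedGraph V) {t : ℕ} {c : V → Fin t}
    (hc : G.IsValidColoring c) (i j : Fin t) :
    ∃ s : {v // c v = i ∨ c v = j} → ℝ, (∀ v, s v * s v = 1) ∧
      ∀ u v : {v // c v = i ∨ c v = j}, G.adjMat u v = s u * s v * TwoDistance.adjMat G.underlying u v := by
  classical
  -- The product of the two signs is `1` within a class and `-1` across, matching the edge labels.
  refine ⟨fun v => if c v = i then 1 else -1, fun v => by dsimp only; split_ifs <;> simp, ?_⟩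
  rintro ⟨u, hu⟩ ⟨v, hv⟩
  simp only [SignedGraph.adjMat, of_apply]
  by_cases hp : G.pos.Adj u v
  · rw [if_pos hp, adjMat_apply_of_adj (Or.inl hp), hc.2 u v hp]
    split_ifs <;> simp
  by_cases hn : G.neg.Adj u v
  · rw [if_neg hp, if_pos hn, adjMat_apply_of_adj (Or.inr hn)]
    have := hc.1 u v hn
    by_cases h1 : c u = i <;> by_cases h2 : c v = i
    · exact absurd (h1.trans h2.symm) this
    · simp [h1, h2]
    · simp [h1, h2]
    · exact absurd ((hu.resolve_left h1).trans (hv.resolve_left h2).symm) this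
  · rw [if_neg hp, if_neg hn, adjMat_apply_of_not_adj (not_or.2 ⟨hp, hn⟩), mul_zero]

variable [Fintype V] [DecidableEq V]

/-- The rank of `x - A` is at least its rank on any two color classes. -/
theorem SignedGraph.mul_card_two_classes_le (G : SignedGraph V) {t : ℕ} {c : V → Fin t}
    (hc : G.IsValidColoring c) {x : ℝ} (hM : (x • (1 : Matrix V V ℝ) - G.adjMat).PosSemidef)
    {k : ℕ} (hk : spectralRadiusOrder x = k) (i j : Fin t) :
    k * Fintype.card {v // c v = i ∨ c v = j} ≤
      k * (x • (1 : Matrix V V ℝ) - G.adjMat).rank +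
        Fintype.card {v // c v = i ∨ c v = j} := by
  let W := {v // c v = i ∨ c v = j}
  obtain ⟨s, hs, hA⟩ : ∃ s : W → ℝ, (∀ v, s v * s v = 1) ∧
      ∀ u v : W, G.adjMat u v = s u * s v * TwoDistance.adjMat G.underlying u v :=
    G.exists_switching hc i j
  let H : SimpleGraph W := G.underlying.comap Subtype.val
  let D : Matrix W W ℝ := diagonal s
  have hD : D * D = 1 := by
    rw [diagonal_mul_diagonal, ← diagonal_one]
    exact congrArg _ (funext hs)
  have hDunit : IsUnit D.det := (isUnit_iff_isUnit_det D).1 (IsUnit.of_mul_eq_one _ hD)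
  have hDh : Dᴴ = D := by simp [D]
  have hH : x • (1 : Matrix W W ℝ) - TwoDistance.adjMat H =
      D * (x • (1 : Matrix V V ℝ) - G.adjMat).submatrix Subtype.val Subtype.val * D := by
    rw [submatrix_smul_one_sub _ _ Subtype.val_injective, Matrix.mul_sub, Matrix.sub_mul]
    congr 1
    · simp [hD]
    · ext u v
      have hHu : TwoDistance.adjMat H u v = TwoDistance.adjMat G.underlying u v :=
        congrFun (congrFun (adjMat_comap G.underlying (Subtype.val : W → V)) u) v
      simp only [D, mul_diagonal, diagonal_mul, submatrix_apply]
      rw [hHu, hA]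
      linear_combination (- s v * s v * TwoDistance.adjMat G.underlying u v) * hs u -
        TwoDistance.adjMat G.underlying u v * hs v
  have hps : (x • (1 : Matrix W W ℝ) - TwoDistance.adjMat H).PosSemidef := by
    have := (hM.submatrix (Subtype.val : W → V)).mul_mul_conjTranspose_same D
    rwa [hDh, ← hH] at this
  refine (mul_card_le_mul_rank hk hps).trans ?_
  gcongr
  rw [hH, rank_mul_eq_left_of_isUnit_det _ _ hDunit, rank_mul_eq_right_of_isUnit_det _ _ hDunit]
  exact rank_submatrix_le _ _ _

/-- Averaging the rank bound over cyclically consecutive pairs of color classes. -/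
theorem SignedGraph.two_mul_card_le (G : SignedGraph V) {p : ℕ} (hp : 2 ≤ p) {c : V → Fin p}
    (hc : G.IsValidColoring c) {x : ℝ} (hM : (x • (1 : Matrix V V ℝ) - G.adjMat).PosSemidef)
    {k : ℕ} (hk : spectralRadiusOrder x = k) :
    2 * k * Fintype.card V ≤
      p * (k * (x • (1 : Matrix V V ℝ) - G.adjMat).rank) + 2 * Fintype.card V := by
  -- In `Fin (q + 2)` addition is cyclic and `1 ≠ 0`, so classes `i` and `i + 1` are disjoint; for
  -- `q = 0` the single pair is counted twice, harmlessly.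
  obtain ⟨q, rfl⟩ := Nat.exists_eq_add_of_le' hp
  have hcard : ∀ i : Fin (q + 2), Fintype.card {v // c v = i ∨ c v = i + 1} =
      Fintype.card {v // c v = i} + Fintype.card {v // c v = i + 1} := fun i => by
    rw [Fintype.card_subtype_or_disjoint]
    rw [Pi.disjoint_iff]
    intro v
    rw [Prop.disjoint_iff]
    intro h
    exact one_ne_zero (α := Fin (q + 2)) (left_eq_add.1 (h.1.symm.trans h.2))
  have hsum : ∑ i : Fin (q + 2), Fintype.card {v // c v = i} = Fintype.card V := by
    simp only [Fintype.card_subtype]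
    exact (Finset.card_eq_sum_card_fiberwise fun _ _ => by simp).symm
  have hsum' : ∑ i : Fin (q + 2), Fintype.card {v // c v = i + 1} = Fintype.card V :=
    (Equiv.sum_comp (Equiv.addRight (1 : Fin (q + 2)))
      fun i => Fintype.card {v // c v = i}).trans hsum
  have h := Finset.sum_le_sum fun i (_ : i ∈ Finset.univ) =>
    G.mul_card_two_classes_le hc hM hk i (i + 1)
  simp only [hcard, ← Finset.mul_sum, Finset.sum_add_distrib, hsum, hsum', Finset.sum_const,
    Finset.card_univ, Fintype.card_fin, smul_eq_mul] at h
  linarith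

end SignedGraphs

/-! ### Conclusion -/

/-- The spectral radius is smaller than the spectral radius order. -/
theorem le_sub_one_of_spectralRadiusOrder_eq {x : ℝ} {k : ℕ} (hk : spectralRadiusOrder x = k) :
    x ≤ k - 1 := by
  have hne : {s : ℕ∞ | ∃ k : ℕ, s = k ∧
      ∃ G : SimpleGraph (Fin k), IsTopEigenvalue (adjMat_isHermitian G) x}.Nonempty := by
    by_contra h0
    rw [spectralRadiusOrder, Set.not_nonempty_iff_eq_empty.1 h0, sInf_empty] at hk
    exact ENat.natCast_ne_top k hk.symm
  obtain ⟨t, ht, G, hG⟩ := csInf_mem hne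
  have htk : t = k := by
    rw [spectralRadiusOrder, ht] at hk
    exact_mod_cast hk
  simpa [htk] using hG.le_card_sub_one

end TwoDistance

open TwoDistance Matrix in
theorem corollary4p5 (lam : ℝ) (hlam : 0 < lam) (p : ℕ) (hp : 2 ≤ p) :
    (∀ k : ℕ, TwoDistance.spectralRadiusOrder lam = (k : ℕ∞) →
      0 < (p : ℝ) * (k : ℝ) - 2 * lam ∧
      ENNReal.ofReal ((p : ℝ) * (k : ℝ) / ((p : ℝ) * (k : ℝ) - 2 * lam))
        ≤ TwoDistance.kp p lam) ∧
    (TwoDistance.spectralRadiusOrder lam = ⊤ → 1 ≤ TwoDistance.kp p lam) := by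
  refine ⟨fun k hk => ?_, fun _ => ?_⟩
  · have hlk := le_sub_one_of_spectralRadiusOrder_eq hk
    have hp' : (2 : ℝ) ≤ p := by exact_mod_cast hp
    have hden : 0 < (p : ℝ) * k - 2 * lam := by nlinarith
    refine ⟨hden, le_sInf ?_⟩
    rintro _ ⟨n, G, hG, htop, rfl⟩
    obtain ⟨c, hc⟩ := SignedGraph.exists_validColoring hG
    have h := G.two_mul_card_le hp hc ((isTopEigenvalue_iff _ _).1 htop).1 hk
    have hm := htop.eigMult_pos
    have hr := rank_smul_one_sub_add_eigMult G.adjMat_isHermitian lam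
    set m := eigMult G.adjMat_isHermitian lam
    set r := (lam • (1 : Matrix (Fin n) (Fin n) ℝ) - G.adjMat).rank
    rw [Fintype.card_fin] at h hr
    have hm' : (0 : ℝ) < m := by exact_mod_cast hm
    have h' : 2 * (k : ℝ) * n ≤ p * (k * r) + 2 * n := by exact_mod_cast h
    have hr' : (r : ℝ) + m = n := by exact_mod_cast hr
    rw [← ENNReal.ofReal_natCast, ← ENNReal.ofReal_natCast, ← ENNReal.ofReal_div_of_pos hm']
    refine ENNReal.ofReal_le_ofReal ((div_le_div_iff₀ hden hm').2 ?_)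
    -- Trades `k - 1` for the possibly smaller `λ`.
    have hn : 2 * lam * n ≤ 2 * (k - 1) * n := by gcongr
    have hr2 : (r : ℝ) = n - m := by linarith
    rw [hr2] at h'
    linarith
  -- For infinite `k(λ)`, it suffices that a multiplicity never exceeds the number of vertices.
  · refine le_sInf ?_
    rintro _ ⟨n, G, -, htop, rfl⟩
    have hm := htop.eigMult_pos
    have hr := rank_smul_one_sub_add_eigMult G.adjMat_isHermitian lam
    rw [Fintype.card_fin] at hr
    rw [ENNReal.le_div_iff_mul_le (.inl (by exact_mod_cast hm.ne')) (.inl (by simp)), one_mul]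
    exact_mod_cast (by omega : eigMult G.adjMat_isHermitian lam ≤ n)
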